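/- **Setting.** Let $\mathcal H_I$ be a finite-dimensional Hilbert space with Hamiltonian $\hat H_I$, let $\{|x\rangle\}_x$ be an orthonormal basis with $\hat H_I|x\rangle=h_x|x\rangle$, put $\Pi_x=|x\rangle\langle x|$, and let $P_a$ be the projection onto the eigenspace of $\hat H_I$ with eigenvalue $a$ ($P_a=0$ if $a$ is not an eigenvalue). A *CP-work extraction* is a family $\{\mathcal E_j,w_j\}_{j\in\mathcal J}$, with $\mathcal J$ a discrete set, of completely positive maps $\mathcal E_j$ on the operators of $\mathcal H_I$ such that $\sum_j\mathcal E_j$ is completely positive and trace preserving, together with real numbers $w_j$. It is *level-4* if $\mathcal E_j(\Pi_x)=P_{h_x-w_j}\,\mathcal E_j(\Pi_x)\,P_{h_x-w_j}$ for all $j$ and $x$. A *fully quantum (FQ) work extraction* is a quadruple $\mathcal F=(\mathcal H_E,\hat H_E,U,\rho_E)$ consisting of a Hilbert space $\mathcal H_E$, a (possibly unbounded) Hamiltonian $\hat H_E$ with an orthonormal basis of eigenvectors and spectral decomposition $\hat H_E=\sum_k h_{E,k}P_{E,k}$ (with distinct $h_{E,k}$), a unitary $U$ on $\mathcal H_I\otimes\mathcal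 H_E$, and a density operator $\rho_E$ on $\mathcal H_E$ with finite mean energy. $CP(\mathcal F)$ consists of the operations and values $$\rho_I\mapsto \operatorname{Tr}_E\, U(\rho_I\otimes\rho_E)U^\dagger(\hat 1_I\otimes P_{E,k}),\qquad h_{E,k}-\operatorname{Tr}\hat H_E\rho_E .$$ $\mathcal F$ is *energy-conserving* if $[U,\hat H_I+\hat H_E]=0$. Let $e_1,\dots,e_L$ be real numbers that are linearly independent over $\mathbb Q$ and such that every difference $h_x-h_{y}$ is an integer combination of them. (If $\hat H_I$ is lattice, one may take $L=1$ and $e_1$ the lattice span, the largest $d>0$ such that all $h_x-h_y$ are integer multiples of $d$.) $\mathcal F$ is *shift-invariant* (for $e_1,\dots,e_L$) if $\mathcal H_E=\mathcal H_{E1}\otimes\mathcal H_{E2}$ with $\mathcal H_{E1}=L^2(\mathbb Z^L)$ (the factor $\mathcal H_{E2}$ may be one-dimensional), $\hat H_E=\hat H_{E1}\otimes \hat 1$ with $\hat H_{E1}=\sum_{n\in\mathbb Z^L}\big(\sum_l e_ln_l\big)|n\rangle\langle n|$, and $U$ commutes with each of the $L$ displacement operators $|n\rangle\mapsto|n+\mathbf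 1_l\rangle$ of $\mathcal H_{E1}$, where $\mathbf 1_l$ is the $l$-th unit vector. **Lemma.** Let $\{\mathcal E_j,w_j\}_{j\in\mathcal J}$ be a level-4 CP-work extraction. Then there is an energy-conserving and shift-invariant FQ-work extraction $\mathcal F=(\mathcal H_E,\hat H_E,U,\rho_E)$ such that the support of $\rho_E$ is contained in one eigenspace of $\hat H_E$ and $CP(\mathcal F)=\{\mathcal E_j,w_j\}_{j\in\mathcal J}$, where outcomes are identified by the amount of work that they indicate: for every real $w$, $$\operatorname{Tr}_E\, U(\rho_I\otimes\rho_E)U^\dagger(\hat 1_I\otimes P^E_{w})=\sum_{j:\,w_j=w}\mathcal E_j(\rho_I)\quad\text{for all }\rho_I,$$ where $P^E_{w}$ is the spectral projection of $\hat H_E$ for the value $w+\operatorname{Tr}\hat H_E\rho_E$ (zero if this is not an eigenvalue). Moreover, also if several outcomes have the same value, each single $\mathcal E_j$ is obtained from the same $\mathcal F$ by refining the measurement of $\hat H_E$: there are mutually orthogonal projections $Q_j\le P^E_{w_j}$ $(j\in\mathcal J)$ on $\mathcal H_E$ with $\mathcal E_j(\rho_I)=\operatorname{Tr}_E\, U(\rho_I\otimes\rho_E)U^\dagger(\hat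 1_I\otimes Q_j)$ for all $j$ and $\rho_I$. -/

import Mathlib

open scoped TensorProduct CStarAlgebra

noncomputable section

namespace WorkExtraction

/-! ### CP-work extractions on the internal system

The internal system is a finite-dimensional Hilbert space `H`; operators on it are `H →L[ℂ] H`. -/

section Internal

universe u v

variable (H : Type u) [NormedAddCommGroup H] [InnerProductSpace ℂ H] [FiniteDimensional ℂ H]
  [CompleteSpace H]

/-- A CP-work extraction `{E_j, w_j}_{j ∈ J}`: completely positive maps `E_j` on the operators of
the internal system whose sum exists and is completely positive and trace preserving, together
with real measured values `w_j`. -/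
structure CPWorkExtraction (J : Type v) where
  /-- the operation of the outcome `j` -/
  E : J → ((H →L[ℂ] H) →CP (H →L[ℂ] H))
  /-- the amount of work indicated by the outcome `j` -/
  w : J → ℝ
  /-- the sum `∑ j, E j` -/
  total : (H →L[ℂ] H) →CP (H →L[ℂ] H)
  hasSum_total : ∀ ρ : H →L[ℂ] H, HasSum (fun j => E j ρ) (total ρ)
  trace_total : ∀ ρ : H →L[ℂ] H,
    LinearMap.trace ℂ H (total ρ : H →ₗ[ℂ] H) = LinearMap.trace ℂ H (ρ : H →ₗ[ℂ] H)

variable {H}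

/-- The projection `P_a` onto the eigenspace of the internal Hamiltonian with eigenvalue `a`
(it is `0` if `a` is not an eigenvalue). -/
def energyProjection (HI : H →L[ℂ] H) (a : ℝ) : H →L[ℂ] H :=
  (Module.End.eigenspace (HI : H →ₗ[ℂ] H) (a : ℂ)).starProjection

/-- The level-4 energy conservation law, for the orthonormal energy eigenbasis `b` with
eigenvalues `h`: `E_j(Π_x) = P_{h_x - w_j} E_j(Π_x) P_{h_x - w_j}` with `Π_x = |x⟩⟨x|`. -/
def CPWorkExtraction.IsLevel4 {J : Type v} (G : CPWorkExtraction H J) (HI : H →L[ℂ] H)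
    {X : Type*} [Fintype X] (b : OrthonormalBasis X ℂ H) (h : X → ℝ) : Prop :=
  ∀ (j : J) (x : X),
    G.E j (InnerProductSpace.rankOne ℂ (b x) (b x)) =
      energyProjection HI (h x - G.w j) * G.E j (InnerProductSpace.rankOne ℂ (b x) (b x)) *
        energyProjection HI (h x - G.w j)

end Internal

/-! ### Shifts of a Hilbert basis -/

section Displacement

variable {Ξ K : Type*} [NormedAddCommGroup K] [InnerProductSpace ℂ K] [CompleteSpace K]

/-- The Hilbert basis `ξ ↦ b (σ ξ)`. -/
def permBasis (b : HilbertBasis Ξ ℂ K) (σ : Equiv.Perm Ξ) : HilbertBasis Ξ ℂ K :=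
  HilbertBasis.mk (v := fun ξ => b (σ ξ)) (b.orthonormal.comp σ σ.injective) (by
    have hr : Set.range (fun ξ => b (σ ξ)) = Set.range b := σ.surjective.range_comp b
    rw [hr, b.dense_span])

/-- The unitary operator that sends `b ξ` to `b (σ ξ)` for every `ξ`. -/
def displacement (b : HilbertBasis Ξ ℂ K) (σ : Equiv.Perm Ξ) : K ≃ₗᵢ[ℂ] K :=
  b.repr.trans (permBasis b σ).repr.symm

theorem displacement_apply (b : HilbertBasis Ξ ℂ K) (σ : Equiv.Perm Ξ) (ξ : Ξ) :
    displacement b σ (b ξ) = b (σ ξ) := by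
  classical
  have h1 : displacement b σ (b ξ) = permBasis b σ ξ := by
    rw [displacement, LinearIsometryEquiv.trans_apply, HilbertBasis.repr_self,
      HilbertBasis.repr_symm_single]
  rw [h1, permBasis, HilbertBasis.coe_mk]

end Displacement

/-! ### Fully quantum work extractions

The external system is a Hilbert space `K` whose Hamiltonian `H_E` has discrete spectrum; `H_E` is
given by a Hilbert basis of eigenvectors and their energies, so it may be unbounded. Since `H` is
finite-dimensional, the algebraic tensor product `H ⊗ K` is the Hilbert space of the joint
system. -/

section FullyQuantum

universe u v

/-- A fully quantum work extraction `(K, H_E, U, ρ_E)`. -/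
structure FQWorkExtraction (H : Type u) [NormedAddCommGroup H] [InnerProductSpace ℂ H] where
  /-- the Hilbert space of the external system -/
  K : Type v
  [normedAddCommGroup : NormedAddCommGroup K]
  [innerProductSpace : InnerProductSpace ℂ K]
  [completeSpace : CompleteSpace K]
  /-- the label set of the energy eigenbasis -/
  Ξ : Type v
  /-- an eigenbasis of `H_E` -/
  basis : HilbertBasis Ξ ℂ K
  /-- the eigenvalues of `H_E`, with multiplicity -/
  energy : Ξ → ℝ
  /-- the unitary time evolution of the joint system -/
  U : (H ⊗[ℂ] K) ≃ₗᵢ[ℂ] (H ⊗[ℂ] K)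
  /-- the initial state of the external system, a density operator -/
  state : K →L[ℂ] K
  state_isPositive : state.IsPositive
  state_trace : HasSum (fun ξ => inner ℂ (basis ξ) (state (basis ξ))) 1
  /-- the mean initial energy `Tr H_E ρ_E` exists -/
  state_energy : Summable (fun ξ => energy ξ * (inner ℂ (basis ξ) (state (basis ξ))).re)

namespace FQWorkExtraction

attribute [instance] normedAddCommGroup innerProductSpace completeSpace

variable {H : Type u} [NormedAddCommGroup H] [InnerProductSpace ℂ H]

/-- The mean initial energy `Tr H_E ρ_E`. -/
def meanEnergy (F : FQWorkExtraction H) : ℝ :=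
  ∑' ξ, F.energy ξ * (inner ℂ (F.basis ξ) (F.state (F.basis ξ))).re

/-- The space of the vectors `v` with `H_E v = a v`. -/
def eigenspace (F : FQWorkExtraction H) (a : ℝ) : Submodule ℂ F.K where
  carrier := {v | ∀ ξ, (F.energy ξ : ℂ) * inner ℂ (F.basis ξ) v = a * inner ℂ (F.basis ξ) v}
  add_mem' := by
    intro v v' hv hv' ξ
    rw [inner_add_right, mul_add, mul_add, hv ξ, hv' ξ]
  zero_mem' := by
    intro ξ
    simp
  smul_mem' := by
    intro c v hv ξ
    rw [inner_smul_right, mul_left_comm, hv ξ, mul_left_comm]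

theorem isClosed_eigenspace (F : FQWorkExtraction H) (a : ℝ) :
    IsClosed (F.eigenspace a : Set F.K) := by
  have h : (F.eigenspace a : Set F.K) =
      ⋂ ξ, {v | (F.energy ξ : ℂ) * inner ℂ (F.basis ξ) v = a * inner ℂ (F.basis ξ) v} := by
    ext v
    simp [eigenspace]
  rw [h]
  exact isClosed_iInter fun ξ => isClosed_eq (by fun_prop) (by fun_prop)

instance completeSpace_eigenspace (F : FQWorkExtraction H) (a : ℝ) :
    CompleteSpace (F.eigenspace a) :=
  (F.isClosed_eigenspace a).completeSpace_coe

/-- The spectral projection of `H_E` for the value `a` (it is `0` if `a` is not an eigenvalue). -/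
def spectralProjection (F : FQWorkExtraction H) (a : ℝ) : F.K →L[ℂ] F.K :=
  (F.eigenspace a).starProjection

/-- The support of `ρ_E`, that is, the orthogonal complement of its kernel, is contained in one
eigenspace of `H_E`. -/
def SupportInEigenspace (F : FQWorkExtraction H) : Prop :=
  ∃ a : ℝ, (LinearMap.ker (F.state : F.K →ₗ[ℂ] F.K))ᗮ ≤ F.eigenspace a

/-- The vector `t` is in the domain of `H_I + H_E = H_I ⊗ 1 + 1 ⊗ H_E` and is mapped to `s`. -/
def TotalEnergyMaps (F : FQWorkExtraction H) (HI : H →L[ℂ] H) (t s : H ⊗[ℂ] F.K) : Prop :=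
  ∀ (u : H) (ξ : F.Ξ),
    inner ℂ (u ⊗ₜ[ℂ] F.basis ξ) s =
      inner ℂ (u ⊗ₜ[ℂ] F.basis ξ) (LinearMap.rTensor F.K (HI : H →ₗ[ℂ] H) t) +
        F.energy ξ * inner ℂ (u ⊗ₜ[ℂ] F.basis ξ) t

/-- The energy conservation law `[U, H_I + H_E] = 0`: `U` preserves the domain of `H_I + H_E` and
commutes with it there. -/
def EnergyConserving (F : FQWorkExtraction H) (HI : H →L[ℂ] H) : Prop :=
  ∀ t s, F.TotalEnergyMaps HI t s → F.TotalEnergyMaps HI (F.U t) (F.U s)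

/-- The final joint state `U (ρ ⊗ ρ_E) U†`. -/
def finalState (F : FQWorkExtraction H) (ρ : H →L[ℂ] H) : (H ⊗[ℂ] F.K) →ₗ[ℂ] (H ⊗[ℂ] F.K) :=
  (F.U.toLinearEquiv : (H ⊗[ℂ] F.K) →ₗ[ℂ] (H ⊗[ℂ] F.K)) ∘ₗ
    TensorProduct.map (ρ : H →ₗ[ℂ] H) (F.state : F.K →ₗ[ℂ] F.K) ∘ₗ
      (F.U.symm.toLinearEquiv : (H ⊗[ℂ] F.K) →ₗ[ℂ] (H ⊗[ℂ] F.K))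

/-- `S` is the partial trace `Tr_E T`. -/
def IsPartialTrace (F : FQWorkExtraction H) (T : (H ⊗[ℂ] F.K) →ₗ[ℂ] (H ⊗[ℂ] F.K))
    (S : H →L[ℂ] H) : Prop :=
  ∀ u v : H, HasSum (fun ξ => inner ℂ (u ⊗ₜ[ℂ] F.basis ξ) (T (v ⊗ₜ[ℂ] F.basis ξ)))
    (inner ℂ u (S v))

/-- `S = Tr_E U (ρ ⊗ ρ_E) U† (1 ⊗ Q)`. -/
def IsOperation (F : FQWorkExtraction H) (Q : F.K →L[ℂ] F.K) (ρ S : H →L[ℂ] H) : Prop :=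
  F.IsPartialTrace (F.finalState ρ ∘ₗ LinearMap.lTensor H (Q : F.K →ₗ[ℂ] F.K)) S

/-- `CP(F) = {E_j, w_j}`, outcomes being identified by the amount of work they indicate: the
measurement outcome of `H_E` that indicates the work `w` is the value `w + Tr H_E ρ_E`, and its
operation is the sum of all `E_j` with `w_j = w` (so it is `0` if there is no such `j`). -/
def Realizes [FiniteDimensional ℂ H] [CompleteSpace H] {J : Type*} (F : FQWorkExtraction H)
    (G : CPWorkExtraction H J) : Prop :=
  ∀ (w : ℝ) (ρ : H →L[ℂ] H), ∃ S : H →L[ℂ] H,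
    F.IsOperation (F.spectralProjection (w + F.meanEnergy)) ρ S ∧
      HasSum (fun j : {j : J // G.w j = w} => G.E j ρ) S

/-- Every single operation `E_j` is obtained by a refinement of the measurement of `H_E`, in which
the outcome `j` corresponds to a projection below the spectral projection of `H_E` for the value
`w_j + Tr H_E ρ_E`. -/
def RealizesOutcomes [FiniteDimensional ℂ H] [CompleteSpace H] {J : Type*}
    (F : FQWorkExtraction H) (G : CPWorkExtraction H J) : Prop :=
  ∃ Q : J → (F.K →L[ℂ] F.K),
    (∀ j, IsStarProjection (Q j)) ∧
    (∀ i j, i ≠ j → Q i * Q j = 0) ∧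
    (∀ j, F.spectralProjection (G.w j + F.meanEnergy) * Q j = Q j) ∧
    ∀ (j : J) (ρ : H →L[ℂ] H), F.IsOperation (Q j) ρ (G.E j ρ)

/-- The shift by one step in the direction `l` on the labels `(n, y)`. -/
def shiftPerm {L : ℕ} (Y : Type*) (l : Fin L) : Equiv.Perm ((Fin L → ℤ) × Y) :=
  (Equiv.addRight (Pi.single l 1)).prodCongr (Equiv.refl Y)

/-- Shift invariance for the spacings `e`. The external system is `E1 ⊗ E2`, with eigenbasis
`|n, y⟩` for `n ∈ ℤ^L` and `y ∈ Y`; the Hamiltonian of `E1 = L²(ℤ^L)` is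
`∑ₙ (∑ l, e l * n l) |n⟩⟨n|` and `E2` does not contribute to the energy; the unitary `U` commutes
with each of the `L` displacement operators `|n⟩ ↦ |n + 1_l⟩` of `E1`. There is no system `E2` if
`Y` is a point. -/
def ShiftInvariant {L : ℕ} (F : FQWorkExtraction.{u, v} H) (e : Fin L → ℝ) : Prop :=
  ∃ (Y : Type v) (φ : F.Ξ ≃ (Fin L → ℤ) × Y),
    (∀ ξ, F.energy ξ = ∑ l, e l * ((φ ξ).1 l : ℝ)) ∧
    ∀ (l : Fin L) (t : H ⊗[ℂ] F.K),
      F.U (LinearIsometryEquiv.lTensor H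
          (displacement F.basis ((φ.trans (shiftPerm Y l)).trans φ.symm)) t) =
        LinearIsometryEquiv.lTensor H
          (displacement F.basis ((φ.trans (shiftPerm Y l)).trans φ.symm)) (F.U t)

end FQWorkExtraction

end FullyQuantum

/-- The spacings `e` of the external ladder system fit the internal energies `h`: they are linearly
independent over `ℚ`, and every difference of internal energies is an integer combination of them.
The lattice case is `L = 1`, with the lattice span as the only spacing. -/
def IsLadderSpacing {X : Type*} (h : X → ℝ) {L : ℕ} (e : Fin L → ℝ) : Prop :=
  LinearIndependent ℚ e ∧ ∀ x y, ∃ n : Fin L → ℤ, h x - h y = ∑ l, e l * (n l : ℝ)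

/-- A lattice Hamiltonian: `d` is the lattice span of the energies `h`, the largest positive number
of which all energy differences are integer multiples. -/
def IsLatticeSpan {X : Type*} (h : X → ℝ) (d : ℝ) : Prop :=
  IsGreatest {d : ℝ | 0 < d ∧ ∀ x y, ∃ n : ℤ, h x - h y = d * n} d

theorem IsLatticeSpan.isLadderSpacing {X : Type*} {h : X → ℝ} {d : ℝ} (hd : IsLatticeSpan h d) :
    IsLadderSpacing h (fun _ : Fin 1 => d) := by
  refine ⟨LinearIndependent.of_subsingleton 0 hd.1.1.ne', fun x y => ?_⟩
  obtain ⟨n, hn⟩ := hd.1.2 x y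
  exact ⟨fun _ => n, by simpa using hn⟩

end WorkExtraction

end

noncomputable section

open scoped TensorProduct CStarAlgebra

/-! Write all operations jointly with Kraus operators `A k`, where `k` belongs to the outcome `o k`.
By level 4, a nonzero matrix element of `A k` from `b x` to `b y` forces `h x - h y = w (o k)`. Such
a difference is an integer combination of the spacings, so `w (o k) = ∑ l, e l * m k l` for some `m
k` in `ℤ^L`. (`CPWorkExtraction.exists_kraus_family`, `CPWorkExtraction.IsLevel4.work_eq`)

The external system is the ladder together with an energy-free ancilla with labels `Option κ`,
starting in `|0, none⟩`. The dilation `u ⊗ |n, none⟩ ↦ ∑ k, A k u ⊗ |n + m k, some k⟩` is isometric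
by trace preservation, conserves the total energy and commutes with ladder shifts. Its range is
orthogonal to its domain because the ancilla labels differ. It therefore extends to a unitary that
swaps the two: the reflection in the complement of all differences between a vector and its dilation
(`swapUnitary_tmul_none`). A reflection commutes with every unitary that preserves this span in both
directions, and this gives both shift invariance and energy conservation
(`reflection_orthogonal_comm`).

After the interaction the label `(m k, some k)` carries the operation `ρ ↦ A k ρ (A k)†`
(`hasSum_inner_swapUnitary`). The ladder energy reads off `w (o k)`, and the ancilla separates
outcomes of equal value. -/

namespace WorkExtraction

/-! ### Kraus decomposition by Choi's argument -/

section Kraus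

open InnerProductSpace ContinuousLinearMap

/-- Two linear maps on operators agree if they agree on the matrix units of a basis. -/
theorem linearMap_ext_rankOne {H X V : Type*} [NormedAddCommGroup H] [InnerProductSpace ℂ H]
    [Fintype X] [AddCommGroup V] [Module ℂ V]
    (b : OrthonormalBasis X ℂ H) {f g : (H →L[ℂ] H) →ₗ[ℂ] V}
    (hfg : ∀ x y, f (rankOne ℂ (b x) (b y)) = g (rankOne ℂ (b x) (b y))) : f = g := by
  ext ρ
  have hρ : ρ = ∑ x, ∑ y, inner ℂ (b x) (ρ (b y)) • rankOne ℂ (b x) (b y) := by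
    ext v
    simp only [sum_apply, FunLike.coe_smul, Pi.smul_apply, rankOne_apply]
    conv_lhs => rw [← b.sum_repr' v]
    rw [map_sum, Finset.sum_comm]
    refine Finset.sum_congr rfl fun y _ => ?_
    conv_lhs => rw [map_smul, ← b.sum_repr' (ρ (b y)), Finset.smul_sum]
    exact Finset.sum_congr rfl fun x _ => smul_comm _ _ _
  rw [hρ]
  simp only [map_sum, map_smul, hfg]

theorem exists_eq_star_mul_self_of_nonneg {A : Type*} [CStarAlgebra A] [PartialOrder A]
    [StarOrderedRing A] {a : A} (ha : 0 ≤ a) : ∃ d, a = star d * d :=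
  CStarAlgebra.nonneg_iff_eq_star_mul_self.mp ha

/-- Every completely positive map has a Kraus decomposition. -/
theorem exists_kraus {H X : Type*} [NormedAddCommGroup H] [InnerProductSpace ℂ H]
    [CompleteSpace H] [Fintype X] (b : OrthonormalBasis X ℂ H)
    (E : (H →L[ℂ] H) →CP (H →L[ℂ] H)) :
    ∃ A : X × X → (H →L[ℂ] H), ∀ ρ, E ρ = ∑ i, A i * ρ * adjoint (A i) := by
  classical
  -- The block matrix of all matrix units `|x⟩⟨y|` is positive because it is `star C * C`. The
  -- normalization compensates for the `card X` equal terms in the sum over `z`.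
  obtain ⟨C, hC'⟩ : ∃ C : CStarMatrix X X (H →L[ℂ] H), ∀ z x,
      C z x = ((√(Fintype.card X : ℝ) : ℝ) : ℂ)⁻¹ • rankOne ℂ (b z) (b x) :=
    ⟨CStarMatrix.ofMatrix (Matrix.of fun z x =>
      ((√(Fintype.card X : ℝ) : ℝ) : ℂ)⁻¹ • rankOne ℂ (b z) (b x)), fun _ _ => rfl⟩
  have hC : ∀ x y, (star C * C) x y = rankOne ℂ (b x) (b y) := by
    intro x y
    have hX : (Fintype.card X : ℂ) ≠ 0 := by
      exact_mod_cast (Fintype.card_pos_iff.mpr ⟨x⟩).ne'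
    rw [CStarMatrix.mul_apply]
    have h1 : ∀ z, star C x z * C z y = (Fintype.card X : ℂ)⁻¹ • rankOne ℂ (b x) (b y) := by
      intro z
      rw [CStarMatrix.star_apply, hC', hC', star_smul, star_eq_adjoint, adjoint_rankOne,
        smul_mul_smul_comm, mul_def, rankOne_comp_rankOne]
      simp [← mul_inv, ← Complex.ofReal_mul, Complex.conj_ofReal]
    rw [Finset.sum_congr rfl fun z _ => h1 z]
    simp [← Nat.cast_smul_eq_nsmul ℂ, smul_smul, hX]
  obtain ⟨D, hD⟩ := exists_eq_star_mul_self_of_nonneg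
    (E.map_cstarMatrix_nonneg _ (star_mul_self_nonneg C))
  have hE : ∀ x y, E (rankOne ℂ (b x) (b y)) = ∑ z, adjoint (D z x) * D z y := by
    intro x y
    rw [← hC, ← CStarMatrix.map_apply (f := E), hD, CStarMatrix.mul_apply]
    rfl
  -- Inserting `∑ w, |w⟩⟨w| = 1` into `D(z,x)† D(z,y)` shows which Kraus operators are needed: `A
  -- (z, w)` sends `b x` to `D(z,x)† (b w)`.
  let A : X × X → (H →L[ℂ] H) := fun i =>
    ∑ x, rankOne ℂ (adjoint (D i.1 x) (b i.2)) (b x)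
  have hA : ∀ i x, A i (b x) = adjoint (D i.1 x) (b i.2) := by
    intro i x
    simp [A, sum_apply, b.inner_eq_ite]
  let f : (H →L[ℂ] H) →ₗ[ℂ] (H →L[ℂ] H) :=
    ∑ i, LinearMap.mulLeft ℂ (A i) ∘ₗ LinearMap.mulRight ℂ (adjoint (A i))
  refine ⟨A, fun ρ => ?_⟩
  have hf : (E.toLinearMap : (H →L[ℂ] H) →ₗ[ℂ] (H →L[ℂ] H)) = f := by
    refine linearMap_ext_rankOne b fun x y => (hE x y).trans ?_
    simp only [f, LinearMap.sum_apply, LinearMap.comp_apply, LinearMap.mulLeft_apply,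
      LinearMap.mulRight_apply, Fintype.sum_prod_type]
    refine Finset.sum_congr rfl fun z _ => ?_
    have h2 : ∀ w, A (z, w) * (rankOne ℂ (b x) (b y) * adjoint (A (z, w))) =
        adjoint (D z x) * (rankOne ℂ (b w) (b w) * D z y) := by
      intro w
      simp only [mul_def, rankOne_comp, comp_rankOne, adjoint_adjoint, hA]
    rw [Finset.sum_congr rfl fun w _ => h2 w, ← Finset.mul_sum, ← Finset.sum_mul,
      b.sum_rankOne_eq_id]
    rfl
  have := LinearMap.congr_fun hf ρ
  refine Eq.trans this ?_
  simp only [f, LinearMap.sum_apply, LinearMap.comp_apply, LinearMap.mulLeft_apply,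
      LinearMap.mulRight_apply, mul_assoc]

end Kraus

/-! ### The Hilbert space `H ⊗ K` and its product basis -/

section TensorBasis

variable {H K X Ξ : Type*} [NormedAddCommGroup H] [InnerProductSpace ℂ H] [Fintype X]
  [NormedAddCommGroup K] [InnerProductSpace ℂ K]

/-- The isometry `(k x)ₓ ↦ ∑ x, b x ⊗ k x`. -/
def sumTMul (b : OrthonormalBasis X ℂ H) : PiLp 2 (fun _ : X => K) →ₗᵢ[ℂ] H ⊗[ℂ] K :=
  LinearMap.isometryOfInner
    (∑ x, TensorProduct.mk ℂ H K (b x) ∘ₗ (PiLp.projₗ 2 (𝕜 := ℂ) (fun _ : X => K) x)) (by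
      classical
      intro k k'
      simp [sum_inner, inner_sum, b.inner_eq_ite, PiLp.inner_apply])

theorem sumTMul_apply (b : OrthonormalBasis X ℂ H) (k : PiLp 2 (fun _ : X => K)) :
    sumTMul b k = ∑ x, b x ⊗ₜ[ℂ] k x := by
  change (∑ x, TensorProduct.mk ℂ H K (b x) ∘ₗ
    (PiLp.projₗ 2 (𝕜 := ℂ) (fun _ : X => K) x)) k = _
  simp

theorem sumTMul_surjective (b : OrthonormalBasis X ℂ H) :
    Function.Surjective (sumTMul (K := K) b) := by
  intro t
  induction t with
  | zero => exact ⟨0, map_zero _⟩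
  | add s t hs ht =>
    obtain ⟨k, rfl⟩ := hs
    obtain ⟨k', rfl⟩ := ht
    exact ⟨k + k', map_add _ _ _⟩
  | tmul u v =>
    refine ⟨WithLp.toLp 2 fun x => inner ℂ (b x) u • v, ?_⟩
    rw [sumTMul_apply]
    conv_rhs => rw [← b.sum_repr' u, TensorProduct.sum_tmul]
    simp [TensorProduct.smul_tmul]

/-- For finite-dimensional `H` the algebraic tensor product is isometric to a finite Hilbert sum of
copies of `K`, so no completion is needed. -/
instance completeSpace_tensorProduct [FiniteDimensional ℂ H] [CompleteSpace K] :
    CompleteSpace (H ⊗[ℂ] K) :=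
  ((sumTMul (K := K) (stdOrthonormalBasis ℂ H)).isometry.isUniformInducing.completeSpace_congr
    (sumTMul_surjective _)).mp inferInstance

/-- A vector that is orthogonal to a Hilbert basis vanishes. -/
theorem eq_zero_of_inner_basis_eq_zero (β : HilbertBasis Ξ ℂ K) {v : K}
    (hv : ∀ ξ, inner ℂ (β ξ) v = 0) : v = 0 := by
  apply β.repr.injective
  ext ξ
  simp [β.repr_apply_apply, hv ξ]

variable [FiniteDimensional ℂ H] [CompleteSpace K]

/-- The Hilbert basis `b x ⊗ β ξ` of `H ⊗ K`. -/
def tensorBasis (b : OrthonormalBasis X ℂ H) (β : HilbertBasis Ξ ℂ K) :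
    HilbertBasis (X × Ξ) ℂ (H ⊗[ℂ] K) :=
  HilbertBasis.mkOfOrthogonalEqBot (v := fun p : X × Ξ => b p.1 ⊗ₜ[ℂ] β p.2) (by
      classical
      rw [orthonormal_iff_ite]
      rintro ⟨x, ξ⟩ ⟨y, η⟩
      rw [TensorProduct.inner_tmul, b.inner_eq_ite, orthonormal_iff_ite.mp β.orthonormal]
      by_cases h1 : x = y <;> by_cases h2 : ξ = η <;> simp [h1, h2]) (by
      classical
      rw [eq_bot_iff]
      intro t ht
      obtain ⟨k, rfl⟩ := sumTMul_surjective b t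
      have hk : k = 0 := by
        ext x
        refine eq_zero_of_inner_basis_eq_zero β fun ξ => ?_
        have := (Submodule.mem_orthogonal _ _).mp ht _
          (Submodule.subset_span ⟨(x, ξ), rfl⟩)
        simpa [sumTMul_apply, inner_sum, b.inner_eq_ite] using this
      simp [hk])

@[simp]
theorem tensorBasis_apply (b : OrthonormalBasis X ℂ H) (β : HilbertBasis Ξ ℂ K) (p : X × Ξ) :
    tensorBasis b β p = b p.1 ⊗ₜ[ℂ] β p.2 := by
  rw [tensorBasis, HilbertBasis.coe_mkOfOrthogonalEqBot]

end TensorBasis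

/-! ### Subspaces cut out by vanishing coordinates -/

section Coordinates

variable {E ι : Type*} [NormedAddCommGroup E] [InnerProductSpace ℂ E]

/-- The closed subspace of the vectors whose coordinates outside `S` vanish. -/
def coordSubspace (β : HilbertBasis ι ℂ E) (S : Set ι) : Submodule ℂ E where
  carrier := {v | ∀ i ∉ S, inner ℂ (β i) v = 0}
  add_mem' hv hw i hi := by rw [inner_add_right, hv i hi, hw i hi, add_zero]
  zero_mem' i _ := inner_zero_right _
  smul_mem' c v hv i hi := by rw [inner_smul_right, hv i hi, mul_zero]

theorem mem_coordSubspace {β : HilbertBasis ι ℂ E} {S : Set ι} {v : E} :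
    v ∈ coordSubspace β S ↔ ∀ i ∉ S, inner ℂ (β i) v = 0 := Iff.rfl

theorem isClosed_coordSubspace (β : HilbertBasis ι ℂ E) (S : Set ι) :
    IsClosed (coordSubspace β S : Set E) := by
  have h : (coordSubspace β S : Set E) = ⋂ i ∈ Sᶜ, {v | inner ℂ (β i) v = 0} := by
    ext v
    simp [mem_coordSubspace]
  rw [h]
  exact isClosed_biInter fun i _ => isClosed_eq (by fun_prop) (by fun_prop)

instance completeSpace_coordSubspace [CompleteSpace E] (β : HilbertBasis ι ℂ E) (S : Set ι) :
    CompleteSpace (coordSubspace β S) :=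
  (isClosed_coordSubspace β S).completeSpace_coe

theorem coordSubspace_mono (β : HilbertBasis ι ℂ E) {S T : Set ι} (hST : S ⊆ T) :
    coordSubspace β S ≤ coordSubspace β T :=
  fun _ hv i hi => hv i fun h => hi (hST h)

theorem basis_mem_coordSubspace {β : HilbertBasis ι ℂ E} {S : Set ι} {i : ι} (hi : i ∈ S) :
    β i ∈ coordSubspace β S := by
  intro j hj
  exact β.orthonormal.2 fun hij => hj (hij ▸ hi)

theorem inner_eq_zero_of_mem_coordSubspace {β : HilbertBasis ι ℂ E} {S T : Set ι}
    (hST : Disjoint S T) {v w : E} (hv : v ∈ coordSubspace β S) (hw : w ∈ coordSubspace β T) :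
    inner ℂ v w = 0 := by
  rw [← β.tsum_inner_mul_inner]
  refine (tsum_congr fun i => ?_).trans tsum_zero
  by_cases hi : i ∈ S
  · rw [hw i (hST.notMem_of_mem_left hi), mul_zero]
  · rw [← inner_conj_symm, hv i hi, map_zero, zero_mul]

theorem coordSubspace_isOrtho {β : HilbertBasis ι ℂ E} {S T : Set ι} (hST : Disjoint S T) :
    coordSubspace β S ⟂ coordSubspace β T :=
  Submodule.isOrtho_iff_inner_eq.mpr fun _ hv _ hw => inner_eq_zero_of_mem_coordSubspace hST hv hw

variable [CompleteSpace E]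

theorem starProjection_coordSubspace_basis_of_mem {β : HilbertBasis ι ℂ E} {S : Set ι} {i : ι}
    (hi : i ∈ S) : (coordSubspace β S).starProjection (β i) = β i :=
  Submodule.starProjection_eq_self_iff.mpr (basis_mem_coordSubspace hi)

theorem starProjection_coordSubspace_basis_of_notMem {β : HilbertBasis ι ℂ E} {S : Set ι} {i : ι}
    (hi : i ∉ S) : (coordSubspace β S).starProjection (β i) = 0 := by
  rw [Submodule.starProjection_apply_eq_zero_iff, Submodule.mem_orthogonal']
  exact fun v hv => hv i hi

end Coordinates

/-! ### Reflections and their symmetries -/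

section Reflection

variable {E : Type*} [NormedAddCommGroup E] [InnerProductSpace ℂ E] [CompleteSpace E]

/-- A unitary operator that preserves the span of `S` commutes with the reflection in the
orthogonal complement of `S`. -/
theorem reflection_orthogonal_comm (D : E ≃ₗᵢ[ℂ] E) (S : Set E)
    (hD : ∀ g ∈ S, D g ∈ Submodule.span ℂ S) (hD' : ∀ g ∈ S, D.symm g ∈ Submodule.span ℂ S)
    (t : E) :
    (Submodule.span ℂ S)ᗮ.reflection (D t) = D ((Submodule.span ℂ S)ᗮ.reflection t) := by
  have key : ∀ C : E ≃ₗᵢ[ℂ] E, (∀ g ∈ S, C.symm g ∈ Submodule.span ℂ S) →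
      ∀ p ∈ (Submodule.span ℂ S)ᗮ, C p ∈ (Submodule.span ℂ S)ᗮ := by
    intro C hC p hp
    have hle : Submodule.span ℂ S ≤
        (Submodule.span ℂ S).comap (C.symm.toLinearEquiv : E →ₗ[ℂ] E) :=
      Submodule.span_le.mpr hC
    rw [Submodule.mem_orthogonal]
    intro g hg
    rw [← C.symm.inner_map_map, C.symm_apply_apply]
    exact (Submodule.mem_orthogonal _ _).mp hp _ (hle hg)
  obtain ⟨p, hp, q, hq, rfl⟩ :=
    (Submodule.span ℂ S)ᗮ.exists_add_mem_mem_orthogonal t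
  -- The span need not be closed, so the component `q` is only known to lie in the double
  -- complement, and `D` must be shown to preserve that space.
  have hDq : D q ∈ (Submodule.span ℂ S)ᗮᗮ := by
    rw [Submodule.mem_orthogonal]
    intro r hr
    rw [← D.symm.inner_map_map, D.symm_apply_apply]
    exact (Submodule.mem_orthogonal _ _).mp hq _ (key D.symm (by simpa using hD) r hr)
  simp only [map_add, Submodule.reflection_mem_subspace_eq_self hp,
    Submodule.reflection_mem_subspace_eq_self (key D hD' p hp),
    Submodule.reflection_mem_subspace_orthogonalComplement_eq_neg hq,
    Submodule.reflection_mem_subspace_orthogonalComplement_eq_neg hDq, map_neg]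

/-- The reflection in the orthogonal complement of `S` swaps `v` and `w` if `v - w` is in the
span of `S` and `v + w` is orthogonal to `S`. -/
theorem reflection_orthogonal_apply_eq {S : Set E} {v w : E} (h1 : v - w ∈ Submodule.span ℂ S)
    (h2 : ∀ g ∈ S, inner ℂ g (v + w) = 0) : (Submodule.span ℂ S)ᗮ.reflection v = w := by
  have h2' : v + w ∈ (Submodule.span ℂ S)ᗮ := by
    rw [Submodule.mem_orthogonal']
    intro g hg
    induction hg using Submodule.span_induction with
    | mem g hg => rw [← inner_conj_symm, h2 g hg, map_zero]
    | zero => simp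
    | add x y _ _ hx hy => rw [inner_add_right, hx, hy, add_zero]
    | smul c x _ hx => rw [inner_smul_right, hx, mul_zero]
  have e1 := Submodule.reflection_mem_subspace_eq_self h2'
  have e2 := Submodule.reflection_mem_subspace_orthogonalComplement_eq_neg
    (Submodule.le_orthogonal_orthogonal _ h1)
  rw [map_add] at e1
  rw [map_sub] at e2
  -- The reflection fixes `v + w` and negates `v - w`; the sum of both equations is twice the claim.
  have h3 : (2 : ℂ) • (Submodule.span ℂ S)ᗮ.reflection v = (2 : ℂ) • w := by
    linear_combination (norm := module) e1 + e2
  exact smul_right_injective E (two_ne_zero (α := ℂ)) h3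

/-- The reflection in the orthogonal complement of `S` preserves `coordSubspace β (f ⁻¹' {a})` if
every element of `S` has its coordinates in one of the fibres of `f`. -/
theorem reflection_orthogonal_mem_coordSubspace {ι α : Type*} (β : HilbertBasis ι ℂ E) (f : ι → α)
    {S : Set E} (hS : ∀ g ∈ S, ∃ a, g ∈ coordSubspace β (f ⁻¹' {a})) (a : α) {t : E}
    (ht : t ∈ coordSubspace β (f ⁻¹' {a})) :
    (Submodule.span ℂ S)ᗮ.reflection t ∈ coordSubspace β (f ⁻¹' {a}) := by
  -- The reflection in the coordinate subspace fixes or negates each `g`, hence commutes with the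
  -- reflection in question. Membership in the subspace is being a fixed point.
  have key : ∀ g ∈ S, (coordSubspace β (f ⁻¹' {a})).reflection g ∈ Submodule.span ℂ S := by
    intro g hg
    obtain ⟨a', ha'⟩ := hS g hg
    by_cases haa : a' = a
    · subst haa
      rw [Submodule.reflection_mem_subspace_eq_self ha']
      exact Submodule.subset_span hg
    · rw [Submodule.reflection_mem_subspace_orthogonalComplement_eq_neg
        ((coordSubspace_isOrtho (Disjoint.preimage f (by simpa using haa))).le ha')]
      exact neg_mem (Submodule.subset_span hg)
  rw [← Submodule.reflection_eq_self_iff, ← reflection_orthogonal_comm _ S key (by simpa using key),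
    Submodule.reflection_mem_subspace_eq_self ht]

end Reflection

/-! ### The dilation and the swap unitary -/

section Dilation

variable {H K N κ X : Type*} [NormedAddCommGroup H] [InnerProductSpace ℂ H]
  [NormedAddCommGroup K] [InnerProductSpace ℂ K] [AddCommGroup N]

/-- The dilation `u ↦ ∑ k, A k u ⊗ |n + m k, k⟩` of the Kraus operators `A` with the shifts `m`. -/
def dilation (β : HilbertBasis (N × Option κ) ℂ K) (A : κ → H →L[ℂ] H) (m : κ → N) (n : N)
    (u : H) : H ⊗[ℂ] K :=
  ∑' k, A k u ⊗ₜ[ℂ] β (n + m k, some k)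

/-- The tensor product with a unit vector is an isometry. -/
def tmulUnit {v : K} (hv : ‖v‖ = 1) : H →ₗᵢ[ℂ] H ⊗[ℂ] K where
  toLinearMap := (TensorProduct.mk ℂ H K).flip v
  norm_map' u := by simp [hv]

theorem tmulUnit_apply {v : K} (hv : ‖v‖ = 1) (u : H) : tmulUnit hv u = u ⊗ₜ[ℂ] v := rfl

variable [FiniteDimensional ℂ H] [CompleteSpace K]
  {β : HilbertBasis (N × Option κ) ℂ K} {A : κ → H →L[ℂ] H} {m : κ → N}
  (hA : ∀ u v, HasSum (fun k => inner ℂ (A k u) (A k v)) (inner ℂ u v))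

include hA

/-- Distinct `k` give orthogonal terms through the ancilla label, so convergence reduces to that of
`∑ ‖A k u‖²`, which `hA` provides. -/
theorem hasSum_dilation (n : N) (u : H) :
    HasSum (fun k => A k u ⊗ₜ[ℂ] β (n + m k, some k)) (dilation β A m n u) := by
  refine Summable.hasSum ?_
  have hV : OrthogonalFamily ℂ (fun _ : κ => H)
      (fun k => tmulUnit (β.orthonormal.1 (n + m k, some k))) := by
    intro k k' hk u v
    rw [tmulUnit_apply, tmulUnit_apply, TensorProduct.inner_tmul,
      β.orthonormal.2 (by simpa using fun _ => hk), mul_zero]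
  refine (hV.summable_iff_norm_sq_summable fun k => A k u).mpr ?_
  have h1 := (Complex.hasSum_re (hA u u)).summable
  refine h1.congr fun k => ?_
  exact (inner_self_eq_norm_sq (𝕜 := ℂ) (A k u))

theorem inner_tmul_some_dilation [DecidableEq N] (n n' : N) (k : κ) (u v : H) :
    inner ℂ (u ⊗ₜ[ℂ] β (n', some k)) (dilation β A m n v) =
      if n' = n + m k then inner ℂ u (A k v) else 0 := by
  classical
  have h1 := (hasSum_dilation (β := β) (m := m) hA n v).mapL (innerSL ℂ (u ⊗ₜ[ℂ] β (n', some k)))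
  simp only [innerSL_apply_apply, TensorProduct.inner_tmul,
    orthonormal_iff_ite.mp β.orthonormal, Prod.mk.injEq, Option.some.injEq] at h1
  refine h1.unique ?_
  have h2 := hasSum_ite_eq k (if n' = n + m k then inner ℂ u (A k v) else 0)
  refine h2.congr_fun ?_
  intro k'
  by_cases hk : k' = k
  · subst hk; simp
  · simp [hk, Ne.symm hk]

/-- A dilation carries only labels `some k`; this orthogonality leaves room for a swap. -/
theorem inner_tmul_none_dilation (n n' : N) (u v : H) :
    inner ℂ (u ⊗ₜ[ℂ] β (n', none)) (dilation β A m n v) = 0 := by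
  classical
  have h1 := (hasSum_dilation (β := β) (m := m) hA n v).mapL (innerSL ℂ (u ⊗ₜ[ℂ] β (n', none)))
  simp only [innerSL_apply_apply, TensorProduct.inner_tmul,
    orthonormal_iff_ite.mp β.orthonormal, Prod.mk.injEq, reduceCtorEq, and_false, if_false,
    mul_zero] at h1
  exact h1.unique hasSum_zero

/-- Terms with different `k` are orthogonal through the ancilla, and terms with equal `k` but `n ≠
n'` through the ladder site. What remains for `n = n'` is `hA`. -/
theorem inner_dilation_dilation [DecidableEq N] (n n' : N) (u v : H) :
    inner ℂ (dilation β A m n u) (dilation β A m n' v) = if n = n' then inner ℂ u v else 0 := by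
  have h1 := ((hasSum_dilation (β := β) (m := m) hA n u).mapL
    (innerSL ℂ (dilation β A m n' v)))
  simp only [innerSL_apply_apply] at h1
  refine (inner_conj_symm (E := H ⊗[ℂ] K) _ _).symm.trans (h1.star.unique ?_)
  have h3 : ∀ k, star (inner ℂ (dilation β A m n' v) (A k u ⊗ₜ[ℂ] β (n + m k, some k))) =
      if n = n' then inner ℂ (A k u) (A k v) else 0 := by
    intro k
    refine (inner_conj_symm (E := H ⊗[ℂ] K) _ _).trans ?_
    simp only [inner_tmul_some_dilation hA, add_left_inj]
  simp only [h3]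
  split_ifs
  · exact hA u v
  · exact hasSum_zero

theorem dilation_sum {ι : Type*} [Fintype ι] (n : N) (c : ι → ℂ) (u : ι → H) :
    dilation β A m n (∑ i, c i • u i) = ∑ i, c i • dilation β A m n (u i) := by
  have h1 := hasSum_sum fun i (_ : i ∈ Finset.univ) =>
    (hasSum_dilation (β := β) (m := m) hA n (u i)).const_smul (c i)
  refine (hasSum_dilation hA n _).unique (h1.congr_fun ?_)
  intro k
  simp [TensorProduct.sum_tmul, TensorProduct.smul_tmul']

omit hA

variable [Fintype X]

/-- The difference of the vectors `b x ⊗ |n, none⟩` and their images under the dilation. -/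
def swapVectors (b : OrthonormalBasis X ℂ H) (β : HilbertBasis (N × Option κ) ℂ K)
    (A : κ → H →L[ℂ] H) (m : κ → N) : Set (H ⊗[ℂ] K) :=
  Set.range fun p : X × N => b p.1 ⊗ₜ[ℂ] β (p.2, none) - dilation β A m p.2 (b p.1)

/-- The unitary operator that swaps `u ⊗ |n, none⟩` and the dilation of `u` at `n`. -/
def swapUnitary (b : OrthonormalBasis X ℂ H) (β : HilbertBasis (N × Option κ) ℂ K)
    (A : κ → H →L[ℂ] H) (m : κ → N) : (H ⊗[ℂ] K) ≃ₗᵢ[ℂ] (H ⊗[ℂ] K) :=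
  (Submodule.span ℂ (swapVectors b β A m))ᗮ.reflection

theorem swapUnitary_symm (b : OrthonormalBasis X ℂ H) (β : HilbertBasis (N × Option κ) ℂ K)
    (A : κ → H →L[ℂ] H) (m : κ → N) : (swapUnitary b β A m).symm = swapUnitary b β A m :=
  Submodule.reflection_symm

include hA in
theorem swapUnitary_tmul_none (b : OrthonormalBasis X ℂ H) (n : N) (u : H) :
    swapUnitary b β A m (u ⊗ₜ[ℂ] β (n, none)) = dilation β A m n u := by
  classical
  refine reflection_orthogonal_apply_eq ?_ ?_
  · have h1 : u ⊗ₜ[ℂ] β (n, none) - dilation β A m n u = ∑ x, inner ℂ (b x) u •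
        (b x ⊗ₜ[ℂ] β (n, none) - dilation β A m n (b x)) := by
      conv_lhs => rw [← b.sum_repr' u, dilation_sum hA, TensorProduct.sum_tmul]
      simp only [smul_sub, Finset.sum_sub_distrib, TensorProduct.smul_tmul']
    rw [h1]
    exact Submodule.sum_mem _ fun x _ =>
      Submodule.smul_mem _ _ (Submodule.subset_span ⟨(x, n), rfl⟩)
  -- The mixed products vanish; the two others are equal, since the dilation is isometric, and enter
  -- with opposite signs.
  · rintro _ ⟨⟨x, n'⟩, rfl⟩
    have h2 : inner ℂ (dilation β A m n' (b x)) (u ⊗ₜ[ℂ] β (n, none)) = 0 :=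
      (inner_eq_zero_symm (E := H ⊗[ℂ] K)).mp (inner_tmul_none_dilation hA _ _ _ _)
    simp only [inner_sub_left, inner_add_right, inner_tmul_none_dilation hA, h2,
      inner_dilation_dilation hA, TensorProduct.inner_tmul, orthonormal_iff_ite.mp β.orthonormal,
      Prod.mk.injEq, and_true]
    split_ifs <;> simp

include hA in
/-- A unitary of `K` that shifts `|n⟩` to `|n + l⟩` commutes with the swap. -/
theorem swapUnitary_lTensor (b : OrthonormalBasis X ℂ H) (D : K ≃ₗᵢ[ℂ] K) (l : N)
    (hD : ∀ n y, D (β (n, y)) = β (n + l, y)) (t : H ⊗[ℂ] K) :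
    swapUnitary b β A m (D.lTensor H t) = D.lTensor H (swapUnitary b β A m t) := by
  have key : ∀ (C : K ≃ₗᵢ[ℂ] K) (l : N), (∀ n y, C (β (n, y)) = β (n + l, y)) →
      ∀ g ∈ swapVectors b β A m, C.lTensor H g ∈ Submodule.span ℂ (swapVectors b β A m) := by
    rintro C l hC _ ⟨⟨x, n⟩, rfl⟩
    refine Submodule.subset_span ⟨(x, n + l), ?_⟩
    have h1 : ∀ u y n, C.lTensor H (u ⊗ₜ[ℂ] β (n, y)) = u ⊗ₜ[ℂ] β (n + l, y) := by
      intro u y n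
      rw [LinearIsometryEquiv.lTensor_apply, ← hC]
      rfl
    have h2 : C.lTensor H (dilation β A m n (b x)) = dilation β A m (n + l) (b x) := by
      have h3 := (hasSum_dilation (β := β) (m := m) hA n (b x)).mapL
        (C.lTensor H).toContinuousLinearEquiv.toContinuousLinearMap
      refine h3.unique ((hasSum_dilation hA (n + l) (b x)).congr_fun fun k => ?_)
      rw [add_right_comm, ← h1]
      rfl
    simp only [map_sub, h1, h2]
  refine reflection_orthogonal_comm _ _ (key D l hD) ?_ t
  rw [LinearIsometryEquiv.symm_lTensor]
  refine key D.symm (-l) fun n y => ?_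
  rw [LinearIsometryEquiv.symm_apply_eq, hD, neg_add_cancel_right]

include hA in
/-- The swap preserves total energies if the Kraus operators do. -/
theorem swapUnitary_mem_coordSubspace (b : OrthonormalBasis X ℂ H) (h : X → ℝ)
    (ε : N × Option κ → ℝ)
    (hε : ∀ k x y n, inner ℂ (b y) (A k (b x)) ≠ 0 →
      h y + ε (n + m k, some k) = h x + ε (n, none)) (a : ℝ) {t : H ⊗[ℂ] K}
    (ht : t ∈ coordSubspace (tensorBasis b β) ((fun p => h p.1 + ε p.2) ⁻¹' {a})) :
    swapUnitary b β A m t ∈ coordSubspace (tensorBasis b β) ((fun p => h p.1 + ε p.2) ⁻¹' {a}) := by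
  classical
  refine reflection_orthogonal_mem_coordSubspace _ _ ?_ a ht
  rintro _ ⟨⟨x, n⟩, rfl⟩
  -- Both halves of a swap vector have this one total energy, the second one by `hε`.
  refine ⟨h x + ε (n, none), sub_mem ?_ ?_⟩
  · rw [← tensorBasis_apply b β (x, (n, none))]
    exact basis_mem_coordSubspace rfl
  · rintro ⟨y, n', k | k⟩ hp
    · rw [tensorBasis_apply, inner_tmul_none_dilation hA]
    · rw [tensorBasis_apply, inner_tmul_some_dilation hA]
      split_ifs with hn
      · by_contra hne
        subst hn
        exact hp (hε k x y n hne)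
      · rfl

end Dilation

/-! ### Energy conservation and the operations induced by the swap -/

section SwapUnitary

variable {H K N κ X : Type*} [NormedAddCommGroup H] [InnerProductSpace ℂ H]
  [NormedAddCommGroup K] [InnerProductSpace ℂ K]

/-- Applying `ρ ⊗ |k⟩⟨k|` to `t` gives `ρ w ⊗ k` for the partial inner product `w` of `k` with `t`. -/
theorem exists_map_rankOne_eq (ρ : H →L[ℂ] H) (k : K) (t : H ⊗[ℂ] K) :
    ∃ w : H, (∀ u, inner ℂ u w = inner ℂ (u ⊗ₜ[ℂ] k) t) ∧
      TensorProduct.map (ρ : H →ₗ[ℂ] H)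
        (InnerProductSpace.rankOne ℂ k k : K →ₗ[ℂ] K) t = ρ w ⊗ₜ[ℂ] k := by
  induction t with
  | zero => exact ⟨0, by simp, by simp⟩
  | add t t' ht ht' =>
    obtain ⟨w, h1, h2⟩ := ht
    obtain ⟨w', h1', h2'⟩ := ht'
    refine ⟨w + w', fun u => ?_, ?_⟩
    · rw [inner_add_right, inner_add_right, h1, h1']
    · rw [map_add, h2, h2', map_add, TensorProduct.add_tmul]
  | tmul v k' =>
    refine ⟨inner ℂ k k' • v, fun u => ?_, ?_⟩
    · rw [inner_smul_right, TensorProduct.inner_tmul, mul_comm]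
    · simp [TensorProduct.smul_tmul]

variable [AddCommGroup N] [FiniteDimensional ℂ H] [CompleteSpace K] [Fintype X]

theorem swapUnitary_inner (b : OrthonormalBasis X ℂ H) (β : HilbertBasis (N × Option κ) ℂ K)
    (A : κ → H →L[ℂ] H) (m : κ → N) (v w : H ⊗[ℂ] K) :
    inner ℂ v (swapUnitary b β A m w) = inner ℂ (swapUnitary b β A m v) w := by
  conv_lhs => rw [← swapUnitary_symm]
  exact ((swapUnitary b β A m).inner_map_eq_flip v w).symm

variable {b : OrthonormalBasis X ℂ H} {β : HilbertBasis (N × Option κ) ℂ K}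
  {A : κ → H →L[ℂ] H} {m : κ → N}
  (hA : ∀ u v, HasSum (fun k => inner ℂ (A k u) (A k v)) (inner ℂ u v))

include hA

/-- The swap commutes with the total energy if the Kraus operators preserve it. -/
theorem swapUnitary_totalEnergy {h : X → ℝ} {ε : N × Option κ → ℝ}
    (hε : ∀ k x y n, inner ℂ (b y) (A k (b x)) ≠ 0 →
      h y + ε (n + m k, some k) = h x + ε (n, none)) {t s : H ⊗[ℂ] K}
    (hts : ∀ x ξ, inner ℂ (b x ⊗ₜ[ℂ] β ξ) s =
      ((h x + ε ξ : ℝ) : ℂ) * inner ℂ (b x ⊗ₜ[ℂ] β ξ) t) (x : X) (ξ : N × Option κ) :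
    inner ℂ (b x ⊗ₜ[ℂ] β ξ) (swapUnitary b β A m s) =
      ((h x + ε ξ : ℝ) : ℂ) * inner ℂ (b x ⊗ₜ[ℂ] β ξ) (swapUnitary b β A m t) := by
  -- The swap is self-adjoint, so it can be moved onto the basis vector. The image `f` has a single
  -- total energy, and in the Parseval sums only coordinates of that energy survive.
  have hf := swapUnitary_mem_coordSubspace hA b h ε hε (h x + ε ξ)
    (basis_mem_coordSubspace (β := tensorBasis b β) (i := (x, ξ)) rfl)
  rw [swapUnitary_inner, swapUnitary_inner, ← tensorBasis_apply b β (x, ξ)]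
  generalize swapUnitary b β A m (tensorBasis b β (x, ξ)) = f at hf ⊢
  refine ((tensorBasis b β).tsum_inner_mul_inner f s).symm.trans (Eq.trans ?_
    (congrArg _ ((tensorBasis b β).tsum_inner_mul_inner f t)))
  rw [← tsum_mul_left]
  refine tsum_congr fun p => ?_
  by_cases hp : h p.1 + ε p.2 = h x + ε ξ
  · have h1 : inner ℂ (tensorBasis b β p) s =
        ((h x + ε ξ : ℝ) : ℂ) * inner ℂ (tensorBasis b β p) t := by
      rw [tensorBasis_apply, hts, hp]
    refine (congrArg _ h1).trans ?_
    rw [mul_left_comm]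
  · rw [inner_eq_zero_symm.mp (hf p hp), zero_mul, zero_mul, mul_zero]

/-- The outer swap dilates from the site `0`, which yields `A k` at the site `m k`. The inner swap,
moved across the inner product by self-adjointness, yields the adjoint of `A k`. -/
theorem inner_tmul_swapUnitary_some [DecidableEq N] (ρ : H →L[ℂ] H) (u v : H) (n : N) (k : κ) :
    inner ℂ (u ⊗ₜ[ℂ] β (n, some k)) (swapUnitary b β A m
      (TensorProduct.map (ρ : H →ₗ[ℂ] H)
        (InnerProductSpace.rankOne ℂ (β (0, none)) (β (0, none)) : K →ₗ[ℂ] K)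
          (swapUnitary b β A m (v ⊗ₜ[ℂ] β (n, some k))))) =
      if n = m k then inner ℂ u (A k (ρ (ContinuousLinearMap.adjoint (A k) v))) else 0 := by
  obtain ⟨w, hw, hw'⟩ := exists_map_rankOne_eq ρ (β (0, none))
    (swapUnitary b β A m (v ⊗ₜ[ℂ] β (n, some k)))
  rw [hw', swapUnitary_tmul_none hA, inner_tmul_some_dilation hA, zero_add]
  split_ifs with hn
  · congr 3
    refine ext_inner_left ℂ fun u => ?_
    rw [hw, swapUnitary_inner, swapUnitary_tmul_none hA, ContinuousLinearMap.adjoint_inner_right]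
    refine (inner_conj_symm (E := H ⊗[ℂ] K) _ _).symm.trans ?_
    rw [inner_tmul_some_dilation hA, zero_add, if_pos hn, inner_conj_symm]
  · rfl

theorem inner_tmul_swapUnitary_none (t : H ⊗[ℂ] K) (ρ : H →L[ℂ] H) (u : H) (n : N) :
    inner ℂ (u ⊗ₜ[ℂ] β (n, none)) (swapUnitary b β A m
      (TensorProduct.map (ρ : H →ₗ[ℂ] H)
        (InnerProductSpace.rankOne ℂ (β (0, none)) (β (0, none)) : K →ₗ[ℂ] K) t)) = 0 := by
  obtain ⟨w, -, hw'⟩ := exists_map_rankOne_eq ρ (β (0, none)) t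
  rw [hw', swapUnitary_tmul_none hA, inner_tmul_none_dilation hA]

-- The partial trace over all labels collapses to a sum over `k`, since labels `none` and labels
-- `(n, some k)` with `n ≠ m k` contribute nothing.
open Classical in
theorem hasSum_inner_swapUnitary (S : Set (N × Option κ))
    (ρ : H →L[ℂ] H) (u v : H) {a : ℂ}
    (hT : HasSum (fun k => if (m k, some k) ∈ S then
      inner ℂ u (A k (ρ (ContinuousLinearMap.adjoint (A k) v))) else 0) a) :
    HasSum (fun ξ => inner ℂ (u ⊗ₜ[ℂ] β ξ) (swapUnitary b β A m
      (TensorProduct.map (ρ : H →ₗ[ℂ] H)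
        (InnerProductSpace.rankOne ℂ (β (0, none)) (β (0, none)) : K →ₗ[ℂ] K)
          ((swapUnitary b β A m).symm
            (v ⊗ₜ[ℂ] (coordSubspace β S).starProjection (β ξ)))))) a := by
  simp only [swapUnitary_symm]
  have hinj : Function.Injective fun k => (m k, some k) :=
    fun _ _ hk => Option.some.inj (congrArg Prod.snd hk)
  have key : ∀ ξ, inner ℂ (u ⊗ₜ[ℂ] β ξ) (swapUnitary b β A m (TensorProduct.map (ρ : H →ₗ[ℂ] H)
      (InnerProductSpace.rankOne ℂ (β (0, none)) (β (0, none)) : K →ₗ[ℂ] K)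
        (swapUnitary b β A m (v ⊗ₜ[ℂ] (coordSubspace β S).starProjection (β ξ))))) =
      if ξ ∈ S then inner ℂ (u ⊗ₜ[ℂ] β ξ) (swapUnitary b β A m (TensorProduct.map (ρ : H →ₗ[ℂ] H)
        (InnerProductSpace.rankOne ℂ (β (0, none)) (β (0, none)) : K →ₗ[ℂ] K)
          (swapUnitary b β A m (v ⊗ₜ[ℂ] β ξ)))) else 0 := by
    intro ξ
    split_ifs with hξ
    · rw [starProjection_coordSubspace_basis_of_mem hξ]
    · rw [starProjection_coordSubspace_basis_of_notMem hξ, TensorProduct.tmul_zero, map_zero,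
        map_zero, map_zero, inner_zero_right]
  refine (hinj.hasSum_iff ?_).mp (hT.congr_fun fun k => ?_)
  · rintro ⟨n, k | k⟩ hk
    · rw [key, inner_tmul_swapUnitary_none hA, ite_self]
    · rw [key, inner_tmul_swapUnitary_some hA, if_neg (fun hn : n = m k => hk ⟨k, by rw [hn]⟩),
        ite_self]
  · rw [Function.comp_apply, key, inner_tmul_swapUnitary_some hA, if_pos rfl]

end SwapUnitary

/-! ### The ladder extraction and its properties -/

section LadderExtraction

universe u

variable {H : Type u} [NormedAddCommGroup H] [InnerProductSpace ℂ H]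
  {X : Type*} [Fintype X] {L : ℕ} {κ : Type}

theorem inner_basis_hamiltonian {HI : H →L[ℂ] H} {b : OrthonormalBasis X ℂ H} {h : X → ℝ}
    (hHI : ∀ x, HI (b x) = (h x : ℂ) • b x) (x : X) (v : H) :
    inner ℂ (b x) (HI v) = h x * inner ℂ (b x) v := by
  classical
  conv_lhs => rw [← b.sum_repr' v]
  simp [hHI, b.inner_eq_ite, mul_comm]

/-- In the joint eigenbasis the possibly unbounded total energy becomes multiplication of
coordinates, the form in which the swap is treated. -/
theorem FQWorkExtraction.totalEnergyMaps_iff (F : FQWorkExtraction H) {HI : H →L[ℂ] H}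
    {b : OrthonormalBasis X ℂ H} {h : X → ℝ} (hHI : ∀ x, HI (b x) = (h x : ℂ) • b x)
    (t s : H ⊗[ℂ] F.K) :
    F.TotalEnergyMaps HI t s ↔ ∀ x ξ, inner ℂ (b x ⊗ₜ[ℂ] F.basis ξ) s =
      ((h x + F.energy ξ : ℝ) : ℂ) * inner ℂ (b x ⊗ₜ[ℂ] F.basis ξ) t := by
  have key : ∀ x ξ, inner ℂ (b x ⊗ₜ[ℂ] F.basis ξ)
      (LinearMap.rTensor F.K (HI : H →ₗ[ℂ] H) t) =
        h x * inner ℂ (b x ⊗ₜ[ℂ] F.basis ξ) t := by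
    intro x ξ
    induction t with
    | zero => simp
    | add t t' ht ht' => rw [map_add, inner_add_right, ht, ht', inner_add_right, mul_add]
    | tmul u k =>
      rw [LinearMap.rTensor_tmul, TensorProduct.inner_tmul, TensorProduct.inner_tmul, ← mul_assoc]
      exact congrArg (· * _) (inner_basis_hamiltonian hHI x u)
  constructor
  · intro hts x ξ
    rw [hts (b x) ξ, key]
    push_cast
    ring
  · intro hts u ξ
    rw [← b.sum_repr' u, TensorProduct.sum_tmul]
    simp only [sum_inner, ← TensorProduct.smul_tmul', Finset.mul_sum,
      ← Finset.sum_add_distrib]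
    refine Finset.sum_congr rfl fun x _ => ?_
    rw [inner_smul_left (E := H ⊗[ℂ] F.K), inner_smul_left (E := H ⊗[ℂ] F.K),
      inner_smul_left (E := H ⊗[ℂ] F.K), hts, key]
    push_cast
    ring

theorem FQWorkExtraction.isOperation_iff [CompleteSpace H] (F : FQWorkExtraction H)
    (Q : F.K →L[ℂ] F.K) (ρ T : H →L[ℂ] H) :
    F.IsOperation Q ρ T ↔ ∀ u v, HasSum (fun ξ => inner ℂ (u ⊗ₜ[ℂ] F.basis ξ)
      (F.U (TensorProduct.map (ρ : H →ₗ[ℂ] H) (F.state : F.K →ₗ[ℂ] F.K)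
        (F.U.symm (v ⊗ₜ[ℂ] Q (F.basis ξ)))))) (inner ℂ u (T v)) := Iff.rfl

theorem FQWorkExtraction.eigenspace_eq_coordSubspace (F : FQWorkExtraction H) (a : ℝ) :
    F.eigenspace a = coordSubspace F.basis {ξ | F.energy ξ = a} := by
  ext v
  refine forall_congr' fun ξ => ?_
  rw [mul_eq_mul_right_iff, Complex.ofReal_inj, or_iff_not_imp_left]
  rfl

theorem FQWorkExtraction.spectralProjection_eq (F : FQWorkExtraction H) (a : ℝ) :
    F.spectralProjection a = (coordSubspace F.basis {ξ | F.energy ξ = a}).starProjection := by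
  unfold FQWorkExtraction.spectralProjection
  congr 1
  exact F.eigenspace_eq_coordSubspace a

variable [FiniteDimensional ℂ H]

/-- The basis `|n, y⟩` of the external system with the ladder `L²(ℤ^L)`. -/
def ladderBasis (L : ℕ) (κ : Type) :
    HilbertBasis ((Fin L → ℤ) × Option κ) ℂ (lp (fun _ : (Fin L → ℤ) × Option κ => ℂ) 2) :=
  default

theorem inner_ladderBasis_rankOne [DecidableEq ((Fin L → ℤ) × Option κ)]
    (ξ η : (Fin L → ℤ) × Option κ) :
    inner ℂ (ladderBasis L κ ξ)
      (InnerProductSpace.rankOne ℂ (ladderBasis L κ η) (ladderBasis L κ η) (ladderBasis L κ ξ)) =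
        if ξ = η then 1 else 0 := by
  have h := orthonormal_iff_ite.mp (ladderBasis L κ).orthonormal
  rw [InnerProductSpace.rankOne_apply, inner_smul_right, h, h]
  by_cases hξ : ξ = η <;> simp [hξ]

theorem ladder_energy_mul_inner (e : Fin L → ℝ) (ξ : (Fin L → ℤ) × Option κ) :
    (∑ l, e l * (ξ.1 l : ℝ)) * (inner ℂ (ladderBasis L κ ξ)
      (InnerProductSpace.rankOne ℂ (ladderBasis L κ (0, none)) (ladderBasis L κ (0, none))
        (ladderBasis L κ ξ))).re = 0 := by
  classical
  rw [inner_ladderBasis_rankOne]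
  split_ifs with hξ <;> simp [hξ]

/-- The fully quantum work extraction with a ladder system in the state `|0⟩`, an energy-free
ancilla in the state `none`, and the swap unitary of the Kraus operators `A` and the shifts `m`. -/
def ladderExtraction (b : OrthonormalBasis X ℂ H) (e : Fin L → ℝ) (A : κ → H →L[ℂ] H)
    (m : κ → Fin L → ℤ) : FQWorkExtraction.{u, 0} H where
  K := lp (fun _ : (Fin L → ℤ) × Option κ => ℂ) 2
  Ξ := (Fin L → ℤ) × Option κ
  basis := ladderBasis L κ
  energy ξ := ∑ l, e l * (ξ.1 l : ℝ)
  U := swapUnitary b (ladderBasis L κ) A m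
  state := InnerProductSpace.rankOne ℂ (ladderBasis L κ (0, none)) (ladderBasis L κ (0, none))
  state_isPositive := InnerProductSpace.isPositive_rankOne_self _
  state_trace := by
    classical
    simp only [inner_ladderBasis_rankOne]
    exact hasSum_ite_eq _ _
  state_energy := summable_zero.congr fun ξ => (ladder_energy_mul_inner e ξ).symm

variable {b : OrthonormalBasis X ℂ H} {e : Fin L → ℝ} {A : κ → H →L[ℂ] H} {m : κ → Fin L → ℤ}

theorem ladderExtraction_meanEnergy : (ladderExtraction b e A m).meanEnergy = 0 := by
  exact (tsum_congr fun ξ => ladder_energy_mul_inner e ξ).trans tsum_zero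

/-- Every basis vector except `|0, none⟩` is in the kernel of the state, and that one has energy
`0`. -/
theorem ladderExtraction_supportInEigenspace :
    (ladderExtraction b e A m).SupportInEigenspace := by
  refine ⟨0, fun v hv ξ => ?_⟩
  change ((∑ l, e l * (ξ.1 l : ℝ) : ℝ) : ℂ) * inner ℂ (ladderBasis L κ ξ) v =
    (0 : ℝ) * inner ℂ (ladderBasis L κ ξ) v
  by_cases hξ : ξ = (0, none)
  · subst hξ
    simp
  · have h1 : (ladderExtraction b e A m).basis ξ ∈
        LinearMap.ker ((ladderExtraction b e A m).state :
          (ladderExtraction b e A m).K →ₗ[ℂ] (ladderExtraction b e A m).K) := by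
      change InnerProductSpace.rankOne ℂ (ladderBasis L κ (0, none)) (ladderBasis L κ (0, none))
        (ladderBasis L κ ξ) = 0
      rw [InnerProductSpace.rankOne_apply, (ladderBasis L κ).orthonormal.2 (Ne.symm hξ), zero_smul]
    have h2 : inner ℂ (ladderBasis L κ ξ) v = 0 := (Submodule.mem_orthogonal _ _).mp hv _ h1
    rw [h2, mul_zero, mul_zero]

variable (hA : ∀ u v, HasSum (fun k => inner ℂ (A k u) (A k v)) (inner ℂ u v))

include hA

theorem ladderExtraction_shiftInvariant : (ladderExtraction b e A m).ShiftInvariant e := by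
  refine ⟨Option κ, Equiv.refl _, fun _ => rfl, fun l t => ?_⟩
  exact swapUnitary_lTensor hA b _ (Pi.single l 1)
    (fun n y => displacement_apply (ladderBasis L κ) _ (n, y)) t

theorem ladderExtraction_energyConserving {HI : H →L[ℂ] H} {h : X → ℝ}
    (hHI : ∀ x, HI (b x) = (h x : ℂ) • b x)
    (hm : ∀ k x y, inner ℂ (b y) (A k (b x)) ≠ 0 → h x - h y = ∑ l, e l * (m k l : ℝ)) :
    (ladderExtraction b e A m).EnergyConserving HI := by
  intro t s hts
  rw [FQWorkExtraction.totalEnergyMaps_iff _ hHI] at hts ⊢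
  refine swapUnitary_totalEnergy hA
    (ε := fun ξ : (Fin L → ℤ) × Option κ => ∑ l, e l * (ξ.1 l : ℝ)) ?_ hts
  intro k x y n hne
  simp only [Pi.add_apply, Int.cast_add, mul_add, Finset.sum_add_distrib, ← hm k x y hne]
  ring

open Classical in
theorem ladderExtraction_isOperation (S : Set (ladderExtraction b e A m).Ξ)
    (ρ T : H →L[ℂ] H)
    (hT : ∀ u v, HasSum (fun k => if (m k, some k) ∈ S then
      inner ℂ u (A k (ρ (ContinuousLinearMap.adjoint (A k) v))) else 0) (inner ℂ u (T v))) :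
    (ladderExtraction b e A m).IsOperation
      (coordSubspace (ladderExtraction b e A m).basis S).starProjection ρ T := by
  rw [FQWorkExtraction.isOperation_iff]
  intro u v
  have := hasSum_inner_swapUnitary (b := b) (β := ladderBasis L κ) hA S ρ u v (hT u v)
  exact this

open Classical in
theorem ladderExtraction_isOperation_spectralProjection (w : ℝ) (ρ T : H →L[ℂ] H)
    (hT : ∀ u v, HasSum (fun k => if ∑ l, e l * (m k l : ℝ) = w then
      inner ℂ u (A k (ρ (ContinuousLinearMap.adjoint (A k) v))) else 0) (inner ℂ u (T v))) :
    (ladderExtraction b e A m).IsOperation ((ladderExtraction b e A m).spectralProjection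
      (w + (ladderExtraction b e A m).meanEnergy)) ρ T := by
  rw [FQWorkExtraction.spectralProjection_eq, ladderExtraction_meanEnergy, add_zero]
  refine ladderExtraction_isOperation hA _ ρ T fun u v => ?_
  exact hT u v

/-- The projection onto the states of the external system that the outcome `j` leaves behind. -/
def outcomeProjection (b : OrthonormalBasis X ℂ H) (e : Fin L → ℝ) (A : κ → H →L[ℂ] H)
    (m : κ → Fin L → ℤ) {J : Type*} (o : κ → J) (j : J) :
    (ladderExtraction b e A m).K →L[ℂ] (ladderExtraction b e A m).K :=
  (coordSubspace (ladderExtraction b e A m).basis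
    ((fun k => (m k, some k)) '' (o ⁻¹' {j}))).starProjection

omit hA in
theorem isStarProjection_outcomeProjection {J : Type*} (o : κ → J) (j : J) :
    IsStarProjection (outcomeProjection b e A m o j) :=
  isStarProjection_starProjection

omit hA in
theorem label_injective (m : κ → Fin L → ℤ) : Function.Injective fun k => (m k, some k) :=
  fun _ _ hk => Option.some.inj (congrArg Prod.snd hk)

omit hA in
theorem outcomeProjection_mul_outcomeProjection {J : Type*} (o : κ → J) {i j : J} (hij : i ≠ j) :
    outcomeProjection b e A m o i * outcomeProjection b e A m o j = 0 := by
  refine Submodule.starProjection_comp_starProjection_eq_zero_iff.mpr (coordSubspace_isOrtho ?_)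
  exact (Set.disjoint_image_iff (label_injective m)).mpr
    (Disjoint.preimage o (Set.disjoint_singleton.mpr hij))

omit hA in
theorem spectralProjection_mul_outcomeProjection {J : Type*} {o : κ → J} {w : J → ℝ}
    (hm : ∀ k, w (o k) = ∑ l, e l * (m k l : ℝ)) (j : J) :
    (ladderExtraction b e A m).spectralProjection (w j + (ladderExtraction b e A m).meanEnergy) *
      outcomeProjection b e A m o j = outcomeProjection b e A m o j := by
  rw [FQWorkExtraction.spectralProjection_eq, ladderExtraction_meanEnergy, add_zero]
  refine ContinuousLinearMap.ext fun v => Submodule.starProjection_eq_self_iff.mpr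
    (coordSubspace_mono (ladderExtraction b e A m).basis ?_ (Submodule.starProjection_apply_mem _ v))
  rintro _ ⟨k, rfl, rfl⟩
  exact (hm k).symm

open Classical in
theorem ladderExtraction_isOperation_outcomeProjection {J : Type*} (o : κ → J) (j : J)
    (ρ T : H →L[ℂ] H)
    (hT : ∀ u v, HasSum (fun k => if o k = j then
      inner ℂ u (A k (ρ (ContinuousLinearMap.adjoint (A k) v))) else 0) (inner ℂ u (T v))) :
    (ladderExtraction b e A m).IsOperation (outcomeProjection b e A m o j) ρ T := by
  refine ladderExtraction_isOperation hA _ ρ T fun u v => (hT u v).congr_fun fun k => ?_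
  exact if_congr ((label_injective m).mem_set_image) rfl rfl

end LadderExtraction

/-! ### A joint Kraus family for all outcomes -/

section KrausFamily

open InnerProductSpace ContinuousLinearMap

variable {H : Type*} [NormedAddCommGroup H] [InnerProductSpace ℂ H] {J : Type*}

/-- The operator norm is at most the Hilbert–Schmidt norm, by Cauchy–Schwarz. This lets traces
control the norms of Kraus operators. -/
theorem norm_sq_le_sum_basis {X : Type*} [Fintype X] (b : OrthonormalBasis X ℂ H)
    (A : H →L[ℂ] H) : ‖A‖ ^ 2 ≤ ∑ x, ‖A (b x)‖ ^ 2 := by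
  have h0 : 0 ≤ ∑ x, ‖A (b x)‖ ^ 2 := Finset.sum_nonneg fun _ _ => sq_nonneg _
  refine (Real.le_sqrt (norm_nonneg _) h0).mp (A.opNorm_le_bound (Real.sqrt_nonneg _) fun v => ?_)
  have h1 : ‖A v‖ ≤ ∑ x, ‖A (b x)‖ * ‖inner ℂ (b x) v‖ := by
    conv_lhs => rw [← b.sum_repr' v, map_sum]
    refine (norm_sum_le _ _).trans (Finset.sum_le_sum fun x _ => ?_)
    rw [map_smul, norm_smul, mul_comm]
  refine h1.trans ((Real.sum_mul_le_sqrt_mul_sqrt _ _ _).trans_eq ?_)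
  rw [b.sum_sq_norm_inner_right, Real.sqrt_sq (norm_nonneg _)]

variable [CompleteSpace H]

theorem inner_kraus {ι : Type*} [Fintype ι] {E : (H →L[ℂ] H) → (H →L[ℂ] H)}
    {A : ι → H →L[ℂ] H} (hE : ∀ ρ, E ρ = ∑ i, A i * ρ * adjoint (A i)) (ρ : H →L[ℂ] H) (u v : H) :
    inner ℂ u (E ρ v) = ∑ i, inner ℂ u (A i (ρ (adjoint (A i) v))) := by
  rw [hE, sum_apply, inner_sum]
  rfl

variable [FiniteDimensional ℂ H]

/-- Only countably many operations of a CP-work extraction do not vanish. -/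
theorem CPWorkExtraction.countable_ne_zero (G : CPWorkExtraction H J) :
    {j | (G.E j).toLinearMap ≠ 0}.Countable := by
  let B := Module.finBasis ℂ (H →L[ℂ] H)
  -- A summable family has countable support, and finitely many operators `B i` detect a nonzero
  -- map.
  refine (Set.countable_iUnion fun i => (G.hasSum_total (B i)).summable.countable_support).mono ?_
  intro j hj
  by_contra hne
  refine hj (B.ext fun i => ?_)
  by_contra hi
  exact hne (Set.mem_iUnion.mpr ⟨i, hi⟩)

theorem hasSum_prod_of_fintype {Q ι : Type*} [Fintype ι] {f : Q × ι → ℂ} (hf : Summable f) {a : ℂ}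
    (ha : HasSum (fun q => ∑ i, f (q, i)) a) : HasSum f a := by
  have h := hf.hasSum.prod_fiberwise fun q => hasSum_fintype fun i => f (q, i)
  rw [ha.unique h]
  exact hf.hasSum

/-- Evaluating the trace on `|v⟩⟨u|` turns trace preservation into the weak form of `∑ A† A = 1`. -/
theorem trace_kraus {ι : Type*} [Fintype ι] {E : (H →L[ℂ] H) → (H →L[ℂ] H)}
    {A : ι → H →L[ℂ] H} (hE : ∀ ρ, E ρ = ∑ i, A i * ρ * adjoint (A i)) (u v : H) :
    LinearMap.trace ℂ H (E (rankOne ℂ v u) : H →ₗ[ℂ] H) = ∑ i, inner ℂ (A i u) (A i v) := by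
  have h1 : ∀ i, A i * rankOne ℂ v u * adjoint (A i) = rankOne ℂ (A i v) (A i u) := by
    intro i
    simp only [mul_def, rankOne_comp, comp_rankOne, adjoint_adjoint]
  simp only [hE, h1]
  rw [toLinearMap_sum, map_sum]
  simp only [trace_rankOne]

theorem CPWorkExtraction.hasSum_trace (G : CPWorkExtraction H J) (ρ : H →L[ℂ] H) :
    HasSum (fun j => LinearMap.trace ℂ H (G.E j ρ : H →ₗ[ℂ] H))
      (LinearMap.trace ℂ H (ρ : H →ₗ[ℂ] H)) := by
  rw [← G.trace_total ρ]
  exact (G.hasSum_total ρ).mapL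
    (LinearMap.toContinuousLinearMap (LinearMap.trace ℂ H ∘ₗ ContinuousLinearMap.coeLM ℂ))

/-- A CP-work extraction has a joint family of Kraus operators with a small index type. -/
theorem CPWorkExtraction.exists_kraus_family {X : Type*} [Fintype X] (b : OrthonormalBasis X ℂ H)
    (G : CPWorkExtraction H J) :
    ∃ (κ : Type) (A : κ → H →L[ℂ] H) (o : κ → J),
      (∀ u v, HasSum (fun k => inner ℂ (A k u) (A k v)) (inner ℂ u v)) ∧
      (∀ k x y, inner ℂ (b y) (A k (b x)) ≠ 0 →
        inner ℂ (b y) (G.E (o k) (rankOne ℂ (b x) (b x)) (b y)) ≠ 0) ∧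
      (∀ k, ∃ x y, inner ℂ (b y) (G.E (o k) (rankOne ℂ (b x) (b x)) (b y)) ≠ 0) ∧
      ∀ (P : J → Prop) [DecidablePred P] (ρ : H →L[ℂ] H) (u v : H) (a : ℂ),
        HasSum (fun j => if P j then inner ℂ u (G.E j ρ v) else 0) a →
        HasSum (fun k => if P (o k) then inner ℂ u (A k (ρ (adjoint (A k) v))) else 0) a := by
  classical
  -- The standard basis is indexed by some `Fin n`, whereas `X` may live in a larger universe. With
  -- the nonzero outcomes numbered by naturals, this puts `κ` in `Type`.
  choose A hA using fun j => exists_kraus (stdOrthonormalBasis ℂ H) (G.E j)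
  let s := {j | (G.E j).toLinearMap ≠ 0}
  have : Countable s := G.countable_ne_zero.to_subtype
  obtain ⟨c, hc⟩ := exists_injective_nat s
  obtain ⟨eqv⟩ : Nonempty (Set.range c ≃ s) := ⟨(Equiv.ofInjective c hc).symm⟩
  have hs : ∀ j ∉ s, ∀ ρ, G.E j ρ = 0 := by
    intro j hj ρ
    exact LinearMap.congr_fun (not_not.mp hj) ρ
  have hsum : ∀ {f : J → ℂ} {a : ℂ}, HasSum f a → (∀ j ∉ s, f j = 0) →
      HasSum (fun q => f (eqv q)) a := by
    intro f a ha hf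
    have h1 : HasSum (fun j : s => f j) a :=
      (hasSum_subtype_iff_of_support_subset fun j hj => by
        by_contra hjs
        exact hj (hf j hjs)).mpr ha
    exact eqv.hasSum_iff.mpr h1
  -- The traces of `E_j(Π_x)` are summable over `j`, and their sum over `x` bounds the squared
  -- norms. Both unconditional sums over `κ` below are dominated by this one.
  have hnorm : Summable fun k : Set.range c × _ => ‖A (eqv k.1) k.2‖ ^ 2 := by
    have h1 : ∀ x, Summable fun q : Set.range c => ∑ i, ‖A (eqv q) i (b x)‖ ^ 2 := by
      intro x
      have h2 := hsum (G.hasSum_trace (rankOne ℂ (b x) (b x)))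
        (fun j hj => by rw [hs j hj]; simp)
      refine (Complex.hasSum_re h2).summable.congr fun q => ?_
      rw [trace_kraus (hA _), Complex.re_sum]
      exact Finset.sum_congr rfl fun i _ => (inner_self_eq_norm_sq (𝕜 := ℂ) _)
    refine (summable_prod_of_nonneg fun _ => sq_nonneg _).mpr
      ⟨fun q => (hasSum_fintype _).summable, ?_⟩
    refine Summable.of_nonneg_of_le (fun q => tsum_nonneg fun i => sq_nonneg _) (fun q => ?_)
      (summable_sum fun x (_ : x ∈ Finset.univ) => h1 x)
    rw [tsum_fintype, Finset.sum_comm]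
    exact Finset.sum_le_sum fun i _ => norm_sq_le_sum_basis b _
  have hne : ∀ j x y, (∃ i, inner ℂ (b y) (A j i (b x)) ≠ 0) →
      inner ℂ (b y) (G.E j (rankOne ℂ (b x) (b x)) (b y)) ≠ 0 := by
    rintro j x y ⟨i, hi⟩ h0
    -- The diagonal element is a sum of squared moduli, so no cancellation can hide a nonzero
    -- transition.
    have h1 : ∀ i, inner ℂ (b y) (A j i (rankOne ℂ (b x) (b x) (adjoint (A j i) (b y)))) =
        ((‖inner ℂ (b y) (A j i (b x))‖ ^ 2 : ℝ) : ℂ) := by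
      intro i
      rw [rankOne_apply, map_smul, inner_smul_right, adjoint_inner_right,
        ← inner_conj_symm (A j i (b x)), mul_comm, Complex.mul_conj, Complex.normSq_eq_norm_sq]
    rw [inner_kraus (hA j), Finset.sum_congr rfl fun i _ => h1 i, ← Complex.ofReal_sum,
      Complex.ofReal_eq_zero, Finset.sum_eq_zero_iff_of_nonneg fun _ _ => sq_nonneg _] at h0
    exact hi (by simpa using h0 i (Finset.mem_univ _))
  refine ⟨Set.range c × _, fun k => A (eqv k.1) k.2, fun k => eqv k.1, fun u v => ?_,
    fun k x y hk => hne _ x y ⟨_, hk⟩, fun k => ?_, fun P _ ρ u v a ha => ?_⟩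
  · refine hasSum_prod_of_fintype ?_ ?_
    · refine Summable.of_norm_bounded (hnorm.mul_right (‖u‖ * ‖v‖)) fun k => ?_
      refine (norm_inner_le_norm _ _).trans ?_
      rw [sq, mul_mul_mul_comm]
      exact mul_le_mul (le_opNorm _ _) (le_opNorm _ _) (norm_nonneg _) (by positivity)
    · have h2 := hsum (G.hasSum_trace (rankOne ℂ v u)) (fun j hj => by rw [hs j hj]; simp)
      rw [trace_rankOne] at h2
      exact h2.congr_fun fun q => (trace_kraus (hA (eqv q)) u v).symm
  -- Without any transition all Kraus operators of the outcome vanish, but only nonzero operations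
  -- were kept.
  · by_contra! hcon
    refine (eqv k.1).2 ?_
    have hA0 : ∀ i, A (eqv k.1) i = 0 := by
      intro i
      refine ContinuousLinearMap.coe_injective (b.toBasis.ext fun x => ?_)
      rw [b.coe_toBasis, coe_coe, ← b.sum_repr' (A (eqv k.1) i (b x))]
      refine Finset.sum_eq_zero fun y _ => ?_
      by_contra hi
      exact hne _ x y ⟨i, left_ne_zero_of_smul hi⟩ (hcon x y)
    ext1 ρ
    refine (hA _ ρ).trans ?_
    simp [hA0]
  · refine hasSum_prod_of_fintype ?_ ?_
    · refine Summable.of_norm_bounded (hnorm.mul_right (‖ρ‖ * ‖u‖ * ‖v‖)) fun k => ?_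
      split_ifs
      · calc _ ≤ ‖u‖ * (‖A (eqv k.1) k.2‖ * (‖ρ‖ * (‖A (eqv k.1) k.2‖ * ‖v‖))) := by
              refine (norm_inner_le_norm _ _).trans ?_
              refine mul_le_mul_of_nonneg_left ?_ (norm_nonneg _)
              refine (le_opNorm _ _).trans (mul_le_mul_of_nonneg_left ?_ (norm_nonneg _))
              refine (le_opNorm _ _).trans (mul_le_mul_of_nonneg_left ?_ (norm_nonneg _))
              refine (le_opNorm _ _).trans_eq ?_
              rw [LinearIsometryEquiv.norm_map]
          _ = _ := by ring
      · rw [norm_zero]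
        positivity
    · refine (hsum ha fun j hj => ?_).congr_fun fun q => ?_
      · rw [hs j hj]
        simp
      · split_ifs
        · exact (inner_kraus (hA (eqv q)) ρ u v).symm
        · exact Finset.sum_const_zero

end KrausFamily

/-! ### Consequences of the level-4 law -/

section Level4

variable {H : Type*} [NormedAddCommGroup H] [InnerProductSpace ℂ H] [CompleteSpace H]
  {J X : Type*} [Fintype X]

theorem energyProjection_basis_eq_zero {HI : H →L[ℂ] H} {b : OrthonormalBasis X ℂ H} {h : X → ℝ}
    (hHI : ∀ x, HI (b x) = (h x : ℂ) • b x) {a : ℝ} {y : X} (hy : h y ≠ a) :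
    energyProjection HI a (b y) = 0 := by
  rw [energyProjection, Submodule.starProjection_apply_eq_zero_iff, Submodule.mem_orthogonal']
  intro v hv
  have h1 : HI v = (a : ℂ) • v := Module.End.mem_eigenspace_iff.mp hv
  have h2 := inner_basis_hamiltonian hHI y v
  rw [h1, inner_smul_right, ← sub_eq_zero, ← sub_mul, mul_eq_zero, sub_eq_zero,
    Complex.ofReal_inj] at h2
  exact h2.resolve_left (Ne.symm hy)

/-- A level-4 operation takes the work `h x - h y` from the transition from `x` to `y`. -/
theorem CPWorkExtraction.IsLevel4.work_eq {G : CPWorkExtraction H J} {HI : H →L[ℂ] H}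
    {b : OrthonormalBasis X ℂ H} {h : X → ℝ} (hG : G.IsLevel4 HI b h)
    (hHI : ∀ x, HI (b x) = (h x : ℂ) • b x) {j : J} {x y : X}
    (hxy : inner ℂ (b y) (G.E j (InnerProductSpace.rankOne ℂ (b x) (b x)) (b y)) ≠ 0) :
    h x - h y = G.w j := by
  by_contra hne
  refine hxy ?_
  have h0 : energyProjection HI (h x - G.w j) (b y) = 0 :=
    energyProjection_basis_eq_zero hHI fun hy => hne (by rw [hy]; ring)
  rw [hG j x, mul_apply_eq_comp, h0, map_zero, inner_zero_right]

end Level4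

end WorkExtraction

end

/-! ### Assembly of the extraction -/

theorem mainTheorem11 {H : Type*} [NormedAddCommGroup H] [InnerProductSpace ℂ H]
    [FiniteDimensional ℂ H] [CompleteSpace H]
    {X : Type*} [Fintype X] (HI : H →L[ℂ] H) (b : OrthonormalBasis X ℂ H) (h : X → ℝ)
    (hHI : ∀ x, HI (b x) = (h x : ℂ) • b x)
    {L : ℕ} (e : Fin L → ℝ) (he : WorkExtraction.IsLadderSpacing h e)
    {J : Type*} (G : WorkExtraction.CPWorkExtraction H J) (hG : G.IsLevel4 HI b h) :
    ∃ F : WorkExtraction.FQWorkExtraction.{_, 0} H,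
      F.EnergyConserving HI ∧ F.ShiftInvariant e ∧ F.SupportInEigenspace ∧
        F.Realizes G ∧ F.RealizesOutcomes G := by
  classical
  obtain ⟨κ, A, o, hA, hA4, hA0, hAG⟩ := G.exists_kraus_family b
  -- Each retained outcome has some transition, so its value is an energy difference. Values of
  -- vanishing operations need not be on the ladder.
  have hm : ∀ k, ∃ n : Fin L → ℤ, G.w (o k) = ∑ l, e l * (n l : ℝ) := by
    intro k
    obtain ⟨x, y, hxy⟩ := hA0 k
    obtain ⟨n, hn⟩ := he.2 x y
    exact ⟨n, by rw [← hG.work_eq hHI hxy, hn]⟩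
  choose m hm using hm
  refine ⟨WorkExtraction.ladderExtraction b e A m,
    WorkExtraction.ladderExtraction_energyConserving hA hHI fun k x y hne => ?_,
    WorkExtraction.ladderExtraction_shiftInvariant hA,
    WorkExtraction.ladderExtraction_supportInEigenspace, fun w ρ => ?_, ?_⟩
  · rw [hG.work_eq hHI (hA4 k x y hne), hm]
  · have hS := ((G.hasSum_total ρ).summable.subtype {j | G.w j = w}).hasSum
    refine ⟨_, ?_, hS⟩
    refine WorkExtraction.ladderExtraction_isOperation_spectralProjection hA w ρ _ fun u v => ?_
    have h1 := (hS.mapL (ContinuousLinearMap.apply ℂ H v)).mapL (innerSL ℂ u)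
    simp only [← hm]
    refine hAG (fun j => G.w j = w) ρ u v _ ?_
    refine (hasSum_subtype_iff_indicator (s := {j | G.w j = w})
      (f := fun j => inner ℂ u (G.E j ρ v)) |>.mp h1).congr_fun fun j => ?_
    simp [Set.indicator_apply]
  -- For an outcome outside the range of `o` the projection is zero.
  · refine ⟨WorkExtraction.outcomeProjection b e A m o,
      WorkExtraction.isStarProjection_outcomeProjection o,
      fun i j hij => WorkExtraction.outcomeProjection_mul_outcomeProjection o hij,
      WorkExtraction.spectralProjection_mul_outcomeProjection hm, fun j ρ => ?_⟩
    refine WorkExtraction.ladderExtraction_isOperation_outcomeProjection hA o j ρ _ fun u v => ?_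
    refine hAG (fun i => i = j) ρ u v _ ?_
    refine (hasSum_ite_eq j (inner ℂ u (G.E j ρ v))).congr_fun fun i => ?_
    split_ifs with hij
    · rw [hij]
    · rfl
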